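/- Let $G=(V,E)$ be a directed acyclic graph with $V=\{v_1,\dots,v_n\}$ and $m=|E|$, given by the lists $D_i$ of out-neighbours of the $v_i$. Let $L$ be its set of sinks and $\hat n=n-|L|\ge 1$; assume that $G$ is topologically sorted ($(v_i,v_j)\in E$ implies $i<j$) and that the sinks are $v_{\hat n+1},\dots,v_n$. Let $f:V\to\{0,1\}$ satisfy $f(v_i)=h_i(f(u_1),\dots,f(u_{d_i}))$ for $1\le i\le\hat n$, where $(u_1,\dots,u_{d_i})=D_i$ and $h_i\in\{\mathrm{AND},\mathrm{OR},\mathrm{NAND}\}$; the values of $f$ at the sinks are arbitrary input data. A quantum dynamic programming algorithm given by quantum query algorithms $Q_1,\dots,Q_{\hat n}$ keeps an array $t[1],\dots,t[\hat n]$ and, for $i=\hat n,\dots,1$, runs $Q_i$ and stores its result in $t[i]$. Here each $Q_i$ accesses the instance and the array only through a black box that answers, at unit cost, queries (in superposition) for a degree $d_i$, a function $h_i$, an entry of a list $D_i$, the value of $f$ at a sink, or a stored value $t[j]$. The running time is the total number of queries, and the algorithm errs if $t[i]\ne f(v_i)$ for some $i\le\hat n$. There is an absolute constant $C>0$ such that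 for all $n\ge\hat n\ge1$ there are $Q_1,\dots,Q_{\hat n}$, depending only on $n$ and $\hat n$, for which on every such instance the running time of every execution is at most $C\sqrt{\hat n m\log\hat n}$ (and also at most $C\sqrt{nm\log n}$), and the probability of error is at most $C/\hat n$. -/

import Mathlib

noncomputable section

/-! Quantum query model -/

/-- A quantum query circuit for a black box `x : A → R`.  The basis states are triples
(address, answer register, workspace); the circuit alternates arbitrary input-independent
unitaries with queries and makes `queries` queries in total. -/
structure QueryCircuit (A R : Type) [Fintype A] [DecidableEq A] [Fintype R] [DecidableEq R] where
  /-- basis of the workspace -/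
  W : Type
  [fintypeW : Fintype W]
  [decEqW : DecidableEq W]
  /-- initial basis state -/
  init : A × R × W
  /-- number of queries -/
  queries : ℕ
  /-- `U 0` is applied before the first query and `U k` after the `k`-th query -/
  U : ℕ → (EuclideanSpace ℂ (A × R × W) ≃ₗᵢ[ℂ] EuclideanSpace ℂ (A × R × W))

attribute [instance] QueryCircuit.fintypeW QueryCircuit.decEqW

namespace QueryCircuit

variable {A R : Type} [Fintype A] [DecidableEq A] [Fintype R] [DecidableEq R] [AddGroup R]

/-- The action of the black box on basis states: `|a, y, w⟩ ↦ |a, y + x a, w⟩`. -/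
def oraclePerm (W : Type) (x : A → R) : Equiv.Perm (A × R × W) where
  toFun z := (z.1, z.2.1 + x z.1, z.2.2)
  invFun z := (z.1, z.2.1 - x z.1, z.2.2)
  left_inv z := by simp
  right_inv z := by simp

/-- The query unitary, the linear extension of `oraclePerm`. -/
def oracle (W : Type) [Fintype W] (x : A → R) :
    EuclideanSpace ℂ (A × R × W) ≃ₗᵢ[ℂ] EuclideanSpace ℂ (A × R × W) :=
  LinearIsometryEquiv.piLpCongrLeft 2 ℂ ℂ (oraclePerm W x)

/-- The state after `k` queries (and the unitary that follows the `k`-th query). -/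
def stateAfter (c : QueryCircuit A R) (x : A → R) : ℕ → EuclideanSpace ℂ (A × R × c.W)
  | 0 => c.U 0 (EuclideanSpace.single c.init 1)
  | k + 1 => c.U (k + 1) (oracle c.W x (c.stateAfter x k))

theorem norm_stateAfter (c : QueryCircuit A R) (x : A → R) (k : ℕ) :
    ‖c.stateAfter x k‖ = 1 := by
  induction k with
  | zero => simp [stateAfter]
  | succ k ih => simp [stateAfter, ih]

theorem sum_prob (c : QueryCircuit A R) (x : A → R) :
    ∑ z, ENNReal.ofReal (‖c.stateAfter x c.queries z‖ ^ 2) = 1 := by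
  rw [← ENNReal.ofReal_sum_of_nonneg (fun _ _ => by positivity),
    ← EuclideanSpace.norm_sq_eq, norm_stateAfter]
  simp

/-- Measurement of the final state in the computational basis. -/
def measure (c : QueryCircuit A R) (x : A → R) : PMF (A × R × c.W) :=
  PMF.ofFintype (fun z => ENNReal.ofReal (‖c.stateAfter x c.queries z‖ ^ 2)) (c.sum_prob x)

end QueryCircuit

/-- A quantum query algorithm with result in `α`: a classical control that runs finitely many
quantum query circuits, each chosen depending on the measured outcomes of the earlier ones. -/
inductive QueryAlg (A R : Type) [Fintype A] [DecidableEq A] [Fintype R] [DecidableEq R]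
    (α : Type) : Type 1
  | ret (a : α) : QueryAlg A R α
  | run (c : QueryCircuit A R) (next : A × R × c.W → QueryAlg A R α) : QueryAlg A R α

/-- The joint distribution of the result and the number of queries made, on black box `x`. -/
def QueryAlg.exec {A R : Type} [Fintype A] [DecidableEq A] [Fintype R] [DecidableEq R]
    [AddGroup R] {α : Type} (x : A → R) : QueryAlg A R α → PMF (α × ℕ)
  | .ret a => PMF.pure (a, 0)
  | .run c next => (c.measure x).bind fun z =>
      (QueryAlg.exec x (next z)).map fun s => (s.1, c.queries + s.2)

/-! Graphs and dynamic programming -/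

/-- A topologically sorted directed acyclic graph with `N` non-sinks, which come first, and
`L` sinks, which come last, given by its adjacency lists. -/
structure SortedDAG (N L : ℕ) where
  /-- `D i` is the list of the out-neighbours of vertex `i` -/
  D : Fin (N + L) → List (Fin (N + L))
  nodup : ∀ i, (D i).Nodup
  sorted : ∀ i, ∀ j ∈ D i, i < j
  nonsink : ∀ i : Fin N, D (Fin.castAdd L i) ≠ []
  sink : ∀ j : Fin L, D (Fin.natAdd N j) = []

/-- The set of edges. -/
def SortedDAG.edges {N L : ℕ} (G : SortedDAG N L) : Finset (Fin (N + L) × Fin (N + L)) :=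
  Finset.univ.filter fun e => e.2 ∈ G.D e.1

/-- The number of edges. -/
def SortedDAG.m {N L : ℕ} (G : SortedDAG N L) : ℕ := G.edges.card

/-- The three transition functions. -/
inductive BoolOp
  | and
  | or
  | nand

def BoolOp.eval : BoolOp → List Bool → Bool
  | .and, l => l.all id
  | .or, l => l.any id
  | .nand, l => !(l.all id)

/-- An instance of a problem with a dynamic programming algorithm: the graph, the transition
function of every non-sink, and the function `f` on the vertices that has to be computed. Its
values at the sinks are arbitrary data. -/
structure BoolDP (N L : ℕ) where
  G : SortedDAG N L
  h : Fin N → BoolOp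
  f : Fin (N + L) → Bool
  f_eq : ∀ i : Fin N,
    f (Fin.castAdd L i) = (h i).eval ((G.D (Fin.castAdd L i)).map f)

/-! The black box -/

/-- The possible queries: out-degree of `i`, transition function of `i`, the entry `p` of the
adjacency list of `i`, and the (stored or sink) value at `j`. -/
inductive Addr (N L : ℕ)
  | deg (i : Fin (N + L))
  | op (i : Fin N)
  | nbr (i p : Fin (N + L))
  | val (j : Fin (N + L))
  deriving DecidableEq, Fintype

def BoolOp.code : BoolOp → ℕ
  | .and => 0
  | .or => 1
  | .nand => 2

/-- The answers; all of them are numbers below `N + L + 3`. -/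
abbrev Ans (N L : ℕ) : Type := ZMod (N + L + 3)

/-- The value of a vertex as the algorithm sees it: the stored result at a non-sink, and the
value of `f` at a sink. -/
def BoolDP.tf {N L : ℕ} (P : BoolDP N L) (t : Fin N → Bool) : Fin (N + L) → Bool :=
  Fin.append t fun j => P.f (Fin.natAdd N j)

/-- The black box, with access to the instance and to the current content `t` of the array of
stored results. An entry beyond the end of an adjacency list reads as `N + L`. -/
def BoolDP.blackBox {N L : ℕ} (P : BoolDP N L) (t : Fin N → Bool) : Addr N L → Ans N L
  | .deg i => ((P.G.D i).length : ℕ)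
  | .op i => ((P.h i).code : ℕ)
  | .nbr i p => if hp : (p : ℕ) < (P.G.D i).length then (((P.G.D i)[(p : ℕ)] : ℕ) : Ans N L)
      else ((N + L : ℕ) : Ans N L)
  | .val j => if P.tf t j then 1 else 0

/-! The quantum dynamic programming algorithm -/

/-- Processing of the non-sink `i`: `t[i] ← Q i`, with the queries added to the counter. -/
def BoolDP.step {N L : ℕ} (P : BoolDP N L) (Q : Fin N → QueryAlg (Addr N L) (Ans N L) Bool)
    (i : Fin N) (s : (Fin N → Bool) × ℕ) : PMF ((Fin N → Bool) × ℕ) :=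
  ((Q i).exec (P.blackBox s.1)).map fun r => (Function.update s.1 i r.1, s.2 + r.2)

/-- The algorithm: process the non-sinks from the last one (executed first) down to the first
one. The result is the joint distribution of the final array and the total number of queries. -/
def BoolDP.run {N L : ℕ} (P : BoolDP N L) (Q : Fin N → QueryAlg (Addr N L) (Ans N L) Bool) :
    PMF ((Fin N → Bool) × ℕ) :=
  (List.finRange N).foldr (fun i p => p.bind (P.step Q i)) (PMF.pure (fun _ => false, 0))

/-- Every possible execution makes at most `B` queries. -/
def BoolDP.RunsWithin {N L : ℕ} (P : BoolDP N L)
    (Q : Fin N → QueryAlg (Addr N L) (Ans N L) Bool) (B : ℝ) : Prop :=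
  ∀ s ∈ (P.run Q).support, (s.2 : ℝ) ≤ B

/-- The probability that some entry of the final array differs from `f`. -/
def BoolDP.errorProb {N L : ℕ} (P : BoolDP N L)
    (Q : Fin N → QueryAlg (Addr N L) (Ans N L) Bool) : ENNReal :=
  (P.run Q).toOuterMeasure {s | ∃ i : Fin N, s.1 i ≠ P.f (Fin.castAdd L i)}

end

/-!
The vertices are evaluated one after another, each by a search among its `d` out-neighbours for a
value that decides its transition function: `false` for AND and NAND, `true` for OR. For a union
bound over the `N` non-sinks, every search must err with probability at most `1 / N ^ 2`, and
`√(d log N)` queries suffice for that. The Cauchy-Schwarz inequality then bounds the sum of these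
costs by `√(N m log N)`.

A search with so few queries cannot repeat Grover's algorithm `log N` times for every possible
number `τ` of marked neighbours. With `R` of the order `log N`, it proceeds as follows
(`schedule`).
* For every `t ≤ min R d` it makes one attempt that is certain to succeed if `τ = t`. The weight of
  the neighbours in the initial state is lowered so that a whole number of rounds turns the state
  into the marked subspace exactly (`attemptFailure_exact`). The cost is `∑ √(d / t)`, which is of
  the order `√(d R)`.
* For `τ > R` it makes `R` attempts for every `j` with `3 ^ j ≤ 2 √(d / R)`, with `(3 ^ j - 1) / 2`
  rounds each, which multiplies the rotation angle by `3 ^ j`. For one of these `j` the sine of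
  the angle is at least `1 / 2` (`exists_tripling`), so all attempts fail with probability at most
  `(3 / 4) ^ R` (`prod_attemptFailure_schedule_le`). The cost is a geometric sum, again of the order
  `√(d R)`.

That `k` rounds fail with probability `cos² ((2k + 1) θ)` is shown in `amplification_failure`, for
the query circuit itself. The marking of a basis state is the result of two queries, the first for
a neighbour and the second for its value, and these are undone in every round. The measured outcome
contains the value that was read, so a search without a marked neighbour never claims to have found
one. The errors of different vertices are combined in `BoolDP.errorProb_le`: the error bound at a
vertex assumes that the values of the later vertices have been stored correctly, whereas the bound
on the number of queries holds for any content of the array.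
-/

noncomputable section

/-! ### Unitaries on a register with a finite computational basis -/

/-- The unitary that permutes the computational basis by `π`. -/
def permUnitary {B : Type} [Fintype B] (π : Equiv.Perm B) :
    EuclideanSpace ℂ B ≃ₗᵢ[ℂ] EuclideanSpace ℂ B :=
  LinearIsometryEquiv.piLpCongrLeft 2 ℂ ℂ π

@[simp]
theorem permUnitary_apply {B : Type} [Fintype B] (π : Equiv.Perm B) (v : EuclideanSpace ℂ B)
    (z : B) : permUnitary π v z = v (π.symm z) := rfl

/-- The diagonal unitary that changes the sign of the basis states satisfying `flag`. -/
def signUnitary {B : Type} [Fintype B] (flag : B → Bool) :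
    EuclideanSpace ℂ B ≃ₗᵢ[ℂ] EuclideanSpace ℂ B :=
  LinearIsometryEquiv.piLpCongrRight 2 fun z =>
    if flag z then LinearIsometryEquiv.neg ℂ else LinearIsometryEquiv.refl ℂ ℂ

@[simp]
theorem signUnitary_apply {B : Type} [Fintype B] (flag : B → Bool) (v : EuclideanSpace ℂ B)
    (z : B) : signUnitary flag v z = if flag z then -v z else v z := by
  unfold signUnitary
  rw [LinearIsometryEquiv.piLpCongrRight_apply]
  by_cases h : flag z <;> simp [h]

/-- Every unit vector can be prepared from a computational basis state. -/
theorem exists_unitary_single_eq {B : Type} [Fintype B] [DecidableEq B] (z₀ : B)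
    (ψ : EuclideanSpace ℂ B) (hψ : ‖ψ‖ = 1) :
    ∃ P : EuclideanSpace ℂ B ≃ₗᵢ[ℂ] EuclideanSpace ℂ B, P (EuclideanSpace.single z₀ 1) = ψ := by
  have hon : Orthonormal ℂ (({z₀} : Set B).domRestrict fun _ => ψ) := by
    refine ⟨fun _ => hψ, fun i j hij => (hij ?_).elim⟩
    exact Subtype.ext (i.2.trans j.2.symm)
  obtain ⟨b, hb⟩ := hon.exists_orthonormalBasis_extension_of_card_eq (by simp)
  exact ⟨b.repr.symm, by simpa using hb z₀ rfl⟩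

/-- A probability distribution on the computational basis is the distribution of the outcome of
measuring a state that can be prepared from a basis state. -/
theorem exists_unitary_norm_sq_eq {B : Type} [Fintype B] [DecidableEq B] (z₀ : B)
    (w : B → ℝ) (hw : ∀ z, 0 ≤ w z) (hw1 : ∑ z, w z = 1) :
    ∃ P : EuclideanSpace ℂ B ≃ₗᵢ[ℂ] EuclideanSpace ℂ B,
      ∀ z, ‖P (EuclideanSpace.single z₀ 1) z‖ ^ 2 = w z := by
  have hz : ∀ z, ‖(WithLp.toLp 2 fun z => ((√(w z) : ℝ) : ℂ) : EuclideanSpace ℂ B) z‖ ^ 2 = w z := by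
    intro z
    simp [Real.sq_sqrt (hw z)]
  obtain ⟨P, hP⟩ := exists_unitary_single_eq z₀ (WithLp.toLp 2 fun z => ((√(w z) : ℝ) : ℂ)) (by
    rw [← sq_eq_sq₀ (norm_nonneg _) zero_le_one, EuclideanSpace.norm_sq_eq]
    simp only [hz, hw1, one_pow])
  exact ⟨P, fun z => by rw [hP, hz]⟩

/-! ### Amplitude amplification -/

section Amplification

variable {A R W : Type} [Fintype A] [DecidableEq A] [Fintype R] [DecidableEq R]
  [AddCommGroup R] [Fintype W] [DecidableEq W]

/-- Negation of the answer register. Conjugating a query with it gives the inverse query. -/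
def negPerm (A R W : Type) [AddCommGroup R] : Equiv.Perm (A × R × W) where
  toFun z := (z.1, -z.2.1, z.2.2)
  invFun z := (z.1, -z.2.1, z.2.2)
  left_inv z := by simp
  right_inv z := by simp

/-- The reversible computation that makes a query, permutes the basis states by `V`, and makes a
second query. -/
def twoQueryPerm (V : Equiv.Perm (A × R × W)) (x : A → R) : Equiv.Perm (A × R × W) :=
  ((QueryCircuit.oraclePerm W x).trans V).trans (QueryCircuit.oraclePerm W x)

/-- The unitaries between the queries of amplitude amplification, for the state prepared by `prep`
and the basis states that `flag` accepts after the computation `twoQueryPerm V x`. A round takes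
four queries: two for the computation, and two for undoing it after the sign change. -/
def amplificationUnitary (init : A × R × W)
    (prep : EuclideanSpace ℂ (A × R × W) ≃ₗᵢ[ℂ] EuclideanSpace ℂ (A × R × W))
    (V : Equiv.Perm (A × R × W)) (flag : A × R × W → Bool) (j : ℕ) :
    EuclideanSpace ℂ (A × R × W) ≃ₗᵢ[ℂ] EuclideanSpace ℂ (A × R × W) :=
  if j = 0 then prep
  else if j % 4 = 1 then permUnitary V
  else if j % 4 = 2 then (signUnitary flag).trans (permUnitary (negPerm A R W))
  else if j % 4 = 3 then
    permUnitary (((negPerm A R W).trans V.symm).trans (negPerm A R W))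
  else (permUnitary (negPerm A R W)).trans
    (ℂ ∙ prep (EuclideanSpace.single init 1)).reflection

/-- Amplitude amplification with `k` rounds. Two further queries at the end perform the
computation `twoQueryPerm V x` once more; the unitary after the last query also negates the answer
register, so that an outcome `z` has to be read as `negPerm A R W z`. -/
def amplification (init : A × R × W)
    (prep : EuclideanSpace ℂ (A × R × W) ≃ₗᵢ[ℂ] EuclideanSpace ℂ (A × R × W))
    (V : Equiv.Perm (A × R × W)) (flag : A × R × W → Bool) (k : ℕ) : QueryCircuit A R where
  W := W
  init := init
  queries := 4 * k + 2
  U := amplificationUnitary init prep V flag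

variable (init : A × R × W)
    (prep : EuclideanSpace ℂ (A × R × W) ≃ₗᵢ[ℂ] EuclideanSpace ℂ (A × R × W))
    (V : Equiv.Perm (A × R × W)) (flag : A × R × W → Bool) (x : A → R)

/-- The state of amplitude amplification after a given number of queries; the number of rounds of
the circuit only determines when the state is measured. -/
def amplificationState : ℕ → EuclideanSpace ℂ (A × R × W)
  | 0 => prep (EuclideanSpace.single init 1)
  | j + 1 => amplificationUnitary init prep V flag (j + 1)
      (QueryCircuit.oracle W x (amplificationState j))

theorem amplification_stateAfter (k j : ℕ) :
    (amplification init prep V flag k).stateAfter x j =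
      amplificationState init prep V flag x j := by
  induction j with
  | zero => rfl
  | succ j ih => rw [QueryCircuit.stateAfter, ih]; rfl

theorem amplification_measure (k : ℕ) (z : A × R × W) :
    (amplification init prep V flag k).measure x z =
      ENNReal.ofReal (‖amplificationState init prep V flag x (4 * k + 2) z‖ ^ 2) := by
  rw [← amplification_stateAfter init prep V flag x k]; rfl

/-- After the two queries of the computation, the state is the one at the start of the round,
permuted, up to signs. -/
theorem amplificationState_add_two (k : ℕ) (z : A × R × W) :
    amplificationState init prep V flag x (4 * k + 2) (negPerm A R W z) =
      if flag z then -amplificationState init prep V flag x (4 * k) ((twoQueryPerm V x).symm z)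
      else amplificationState init prep V flag x (4 * k) ((twoQueryPerm V x).symm z) := by
  have h1 : amplificationUnitary init prep V flag (4 * k + 1) = permUnitary V := by
    simp [amplificationUnitary]
  have h2 : amplificationUnitary init prep V flag (4 * k + 1 + 1) =
      (signUnitary flag).trans (permUnitary (negPerm A R W)) := by
    simp [amplificationUnitary, Nat.add_assoc]
  have hneg : (negPerm A R W).symm (negPerm A R W z) = z := Equiv.symm_apply_apply _ _
  rw [amplificationState, amplificationState, h1, h2, LinearIsometryEquiv.trans_apply,
    permUnitary_apply, signUnitary_apply, hneg]
  rfl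

/-- One round multiplies the marked amplitudes by `-1` and then reflects the state in the line
through the prepared state. -/
theorem amplificationState_add_four (k : ℕ) :
    amplificationState init prep V flag x (4 * (k + 1)) =
      (ℂ ∙ prep (EuclideanSpace.single init 1)).reflection
        (signUnitary (fun z => flag (twoQueryPerm V x z))
          (amplificationState init prep V flag x (4 * k))) := by
  have h3 : amplificationUnitary init prep V flag (4 * k + 2 + 1) =
      permUnitary (((negPerm A R W).trans V.symm).trans (negPerm A R W)) := by
    simp [amplificationUnitary, Nat.add_assoc]
  have h4 : amplificationUnitary init prep V flag (4 * k + 2 + 1 + 1) =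
      (permUnitary (negPerm A R W)).trans
        (ℂ ∙ prep (EuclideanSpace.single init 1)).reflection := by
    simp [amplificationUnitary, Nat.add_assoc]
  rw [show 4 * (k + 1) = 4 * k + 2 + 1 + 1 by ring, amplificationState, amplificationState, h3, h4,
    LinearIsometryEquiv.trans_apply]
  congr 1
  ext z
  set s := amplificationState init prep V flag x (4 * k + 2) with hs
  have key : permUnitary (negPerm A R W) (QueryCircuit.oracle W x
      (permUnitary (((negPerm A R W).trans V.symm).trans (negPerm A R W))
        (QueryCircuit.oracle W x s))) z = s (negPerm A R W (twoQueryPerm V x z)) := by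
    have hperm : (QueryCircuit.oraclePerm W x).symm
        ((((negPerm A R W).trans V.symm).trans (negPerm A R W)).symm
          ((QueryCircuit.oraclePerm W x).symm ((negPerm A R W).symm z))) =
        negPerm A R W (twoQueryPerm V x z) := by
      simp [negPerm, twoQueryPerm, QueryCircuit.oraclePerm, sub_eq_add_neg, add_comm]
    rw [← hperm]
    rfl
  rw [key, hs, amplificationState_add_two, signUnitary_apply, Equiv.symm_apply_apply]

/-- The rotation in the plane spanned by the marked and the unmarked part of the prepared state:
each round turns the state by twice the angle `θ`. The amplitudes are multiplied by `sin θ` and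
`cos θ` so that no case distinction on the vanishing of one part is needed. -/
theorem amplificationState_rounds (θ : ℝ)
    (hs : ∑ z, (if flag (twoQueryPerm V x z) then
      ‖prep (EuclideanSpace.single init 1) z‖ ^ 2 else 0) = Real.sin θ ^ 2)
    (hc : ∑ z, (if flag (twoQueryPerm V x z) then 0 else
      ‖prep (EuclideanSpace.single init 1) z‖ ^ 2) = Real.cos θ ^ 2) (k : ℕ) :
    ∃ a b : ℝ, a * Real.sin θ = Real.sin ((2 * k + 1) * θ) ∧
      b * Real.cos θ = Real.cos ((2 * k + 1) * θ) ∧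
      ∀ z, amplificationState init prep V flag x (4 * k) z =
        ((if flag (twoQueryPerm V x z) then a else b : ℝ) : ℂ) *
          prep (EuclideanSpace.single init 1) z := by
  induction k with
  | zero => exact ⟨1, 1, by simp, by simp, fun z => by simp [amplificationState]⟩
  | succ k ih =>
    obtain ⟨a, b, ha, hb, hz⟩ := ih
    set ψ := prep (EuclideanSpace.single init 1) with hψ
    have hψ1 : ‖ψ‖ = 1 := by simp [hψ]
    have hin : inner ℂ ψ (signUnitary (fun z => flag (twoQueryPerm V x z))
        (amplificationState init prep V flag x (4 * k))) =
        ((-a * Real.sin θ ^ 2 + b * Real.cos θ ^ 2 : ℝ) : ℂ) := by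
      rw [PiLp.inner_apply, ← hs, ← hc, Finset.mul_sum, Finset.mul_sum, ← Finset.sum_add_distrib,
        Complex.ofReal_sum]
      refine Finset.sum_congr rfl fun z _ => ?_
      have hn : ψ z * (starRingEnd ℂ) (ψ z) = ((‖ψ z‖ ^ 2 : ℝ) : ℂ) := by
        rw [Complex.mul_conj, Complex.normSq_eq_norm_sq]
      rw [signUnitary_apply, hz]
      by_cases hf : flag (twoQueryPerm V x z)
      · simp only [hf, if_true, RCLike.inner_apply, mul_zero, add_zero]
        rw [neg_mul, mul_assoc, hn]; push_cast; ring
      · simp only [hf, RCLike.inner_apply, mul_zero, zero_add, if_false, Bool.false_eq_true]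
        rw [mul_assoc, hn]; push_cast; ring
    refine ⟨2 * (-a * Real.sin θ ^ 2 + b * Real.cos θ ^ 2) + a,
      2 * (-a * Real.sin θ ^ 2 + b * Real.cos θ ^ 2) - b, ?_, ?_, fun z => ?_⟩
    · have h : ((2 * ((k + 1 : ℕ) : ℝ) + 1) * θ) = (2 * k + 1) * θ + 2 * θ := by push_cast; ring
      rw [h, Real.sin_add, ← ha, ← hb, Real.sin_two_mul, Real.cos_two_mul]
      linear_combination (-2 * a * Real.sin θ) * Real.sin_sq_add_cos_sq θ
    · have h : ((2 * ((k + 1 : ℕ) : ℝ) + 1) * θ) = (2 * k + 1) * θ + 2 * θ := by push_cast; ring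
      rw [h, Real.cos_add, ← ha, ← hb, Real.sin_two_mul, Real.cos_two_mul]
      ring
    · rw [amplificationState_add_four, ← hψ, Submodule.reflection_singleton_apply, hin, hψ1]
      simp only [PiLp.sub_apply, PiLp.smul_apply, signUnitary_apply, hz]
      by_cases hf : flag (twoQueryPerm V x z)
      · simp [hf]; ring
      · simp [hf]; ring

/-- Amplitude amplification fails with probability `cos² ((2k + 1) θ)` if the marked part of the
prepared state has squared norm `sin² θ`. -/
theorem amplification_failure (θ : ℝ)
    (hs : ∑ z, (if flag (twoQueryPerm V x z) then
      ‖prep (EuclideanSpace.single init 1) z‖ ^ 2 else 0) = Real.sin θ ^ 2) (k : ℕ) :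
    ∑ z : A × R × W, (if flag (negPerm A R W z) then 0 else
      (amplification init prep V flag k).measure x z) =
      ENNReal.ofReal (Real.cos ((2 * k + 1) * θ) ^ 2) := by
  have hone : ∑ z, ‖prep (EuclideanSpace.single init 1) z‖ ^ 2 = 1 := by
    rw [← EuclideanSpace.norm_sq_eq]; simp
  have hc : ∑ z, (if flag (twoQueryPerm V x z) then 0 else
      ‖prep (EuclideanSpace.single init 1) z‖ ^ 2) = Real.cos θ ^ 2 := by
    rw [Real.cos_sq', ← hs, ← hone, eq_sub_iff_add_eq, ← Finset.sum_add_distrib]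
    refine Finset.sum_congr rfl fun z _ => ?_
    split_ifs <;> simp
  obtain ⟨a, b, -, hb, hz⟩ := amplificationState_rounds init prep V flag x θ hs hc k
  have hterm : ∀ z, (if flag (negPerm A R W (negPerm A R W (twoQueryPerm V x z))) then 0 else
      (amplification init prep V flag k).measure x (negPerm A R W (twoQueryPerm V x z))) =
      ENNReal.ofReal (b ^ 2 * (if flag (twoQueryPerm V x z) then 0 else
        ‖prep (EuclideanSpace.single init 1) z‖ ^ 2)) := by
    intro z
    have hnn : negPerm A R W (negPerm A R W (twoQueryPerm V x z)) = twoQueryPerm V x z :=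
      (negPerm A R W).symm_apply_apply _
    rw [hnn]
    by_cases hf : flag (twoQueryPerm V x z)
    · simp [hf]
    · simp only [hf, if_false, Bool.false_eq_true]
      rw [amplification_measure, amplificationState_add_two, Equiv.symm_apply_apply, hz]
      simp [hf, mul_pow]
  refine (Equiv.sum_comp ((twoQueryPerm V x).trans (negPerm A R W)) _).symm.trans ?_
  refine (Finset.sum_congr rfl fun z _ => hterm z).trans ?_
  rw [← ENNReal.ofReal_sum_of_nonneg, ← Finset.mul_sum, hc,
    ← hb, mul_pow]
  intro z _
  split_ifs <;> positivity

end Amplification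

/-! ### The schedule of attempts of a search among `d` items -/

/-- The number of rounds that suffices for rotating an angle `θ` with `sin² θ = t / d` to `π / 2`. -/
def exactRounds (d t : ℕ) : ℕ := ⌈√((d : ℝ) / t)⌉₊

/-- The weight of the items in the prepared state for which `exactRounds d t` rounds turn the state
into the marked one exactly, if `t` of the `d` items are marked. -/
def exactWeight (d t : ℕ) : ℝ :=
  (d : ℝ) / t * Real.sin (Real.pi / (2 * (2 * exactRounds d t + 1))) ^ 2

/-- The attempts, given as pairs of a number of rounds and a weight of the items in the prepared
state, that are certain to succeed for one number of marked items from `1` to `R` each. -/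
def exactSchedule (d R : ℕ) : List (ℕ × ℝ) :=
  (List.range (min R d)).map fun t => (exactRounds d (t + 1), exactWeight d (t + 1))

/-- The exponents `j` for which the rotation angle multiplied by `3 ^ j` is of interest when more
than `R` items are marked. -/
def tripling (d R : ℕ) : List ℕ :=
  (List.range (2 * d + 1)).filter fun j => (3 : ℝ) ^ j ≤ 2 * √((d : ℝ) / R)

/-- Attempts with `(3 ^ j - 1) / 2` rounds, which multiply the angle by `3 ^ j`. -/
def triplingSchedule (d R : ℕ) : List (ℕ × ℝ) :=
  (List.replicate R ((tripling d R).map fun j => ((3 ^ j - 1) / 2, (1 : ℝ)))).flatten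

/-- The attempts of the search: the exact ones cover up to `R` marked items, the `R`-fold repeated
ones cover more than `R` marked items. -/
def schedule (d R : ℕ) : List (ℕ × ℝ) := exactSchedule d R ++ triplingSchedule d R

/-- The probability that an attempt with `a.1` rounds and weight `a.2` fails if `τ` of the `d` items
are marked. -/
def attemptFailure (d τ : ℕ) (a : ℕ × ℝ) : ℝ :=
  Real.cos ((2 * a.1 + 1) * Real.arcsin √(a.2 * τ / d)) ^ 2

theorem attemptFailure_nonneg (d τ : ℕ) (a : ℕ × ℝ) : 0 ≤ attemptFailure d τ a := sq_nonneg _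

theorem attemptFailure_le_one (d τ : ℕ) (a : ℕ × ℝ) : attemptFailure d τ a ≤ 1 :=
  Real.cos_sq_le_one _

@[simp]
theorem attemptFailure_zero (d : ℕ) (a : ℕ × ℝ) : attemptFailure d 0 a = 1 := by
  simp [attemptFailure]

theorem prod_map_attemptFailure_nonneg (d τ : ℕ) (l : List (ℕ × ℝ)) :
    0 ≤ (l.map (attemptFailure d τ)).prod := by
  refine List.prod_nonneg fun y hy => ?_
  obtain ⟨a, -, rfl⟩ := List.mem_map.1 hy
  exact attemptFailure_nonneg d τ a

theorem prod_map_attemptFailure_le_one (d τ : ℕ) (l : List (ℕ × ℝ)) :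
    (l.map (attemptFailure d τ)).prod ≤ 1 := by
  induction l with
  | nil => simp
  | cons a l ih =>
    rw [List.map_cons, List.prod_cons]
    exact mul_le_one₀ (attemptFailure_le_one d τ a) (prod_map_attemptFailure_nonneg d τ l) ih

theorem prod_map_attemptFailure_le_of_mem (d τ : ℕ) {l : List (ℕ × ℝ)} {a : ℕ × ℝ} (ha : a ∈ l) :
    (l.map (attemptFailure d τ)).prod ≤ attemptFailure d τ a := by
  induction l with
  | nil => simp at ha
  | cons b l ih =>
    rw [List.map_cons, List.prod_cons]
    rcases List.mem_cons.1 ha with rfl | h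
    · exact mul_le_of_le_one_right (attemptFailure_nonneg _ _ _)
        (prod_map_attemptFailure_le_one d τ l)
    · exact (mul_le_of_le_one_left (prod_map_attemptFailure_nonneg d τ l)
        (attemptFailure_le_one _ _ _)).trans (ih h)

theorem exactAngle_mem (d t : ℕ) :
    0 < Real.pi / (2 * (2 * (exactRounds d t : ℝ) + 1)) ∧
      Real.pi / (2 * (2 * (exactRounds d t : ℝ) + 1)) ≤ Real.pi / 2 := by
  have hk : (0 : ℝ) ≤ exactRounds d t := Nat.cast_nonneg _
  refine ⟨by have := Real.pi_pos; positivity, ?_⟩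
  exact div_le_div_of_nonneg_left Real.pi_pos.le two_pos (by linarith)

theorem sin_exactAngle_le {d t : ℕ} (hd : 0 < d) (ht : 0 < t) :
    Real.sin (Real.pi / (2 * (2 * (exactRounds d t : ℝ) + 1))) ^ 2 ≤ (t : ℝ) / d := by
  have hd' : (0 : ℝ) < d := Nat.cast_pos.2 hd
  have ht' : (0 : ℝ) < t := Nat.cast_pos.2 ht
  obtain ⟨h0, h1⟩ := exactAngle_mem d t
  have hs : 0 < √((d : ℝ) / t) := Real.sqrt_pos.2 (by positivity)
  have hk : √((d : ℝ) / t) ≤ exactRounds d t := Nat.le_ceil _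
  have hsin : Real.sin (Real.pi / (2 * (2 * (exactRounds d t : ℝ) + 1))) ≤ 1 / √((d : ℝ) / t) := by
    refine (Real.sin_le h0.le).trans ?_
    rw [div_le_div_iff₀ (by linarith) hs]
    nlinarith [Real.pi_lt_four, Real.pi_pos]
  have hnn : 0 ≤ Real.sin (Real.pi / (2 * (2 * (exactRounds d t : ℝ) + 1))) :=
    Real.sin_nonneg_of_nonneg_of_le_pi h0.le (by linarith [Real.pi_pos])
  calc _ ≤ (1 / √((d : ℝ) / t)) ^ 2 := pow_le_pow_left₀ hnn hsin 2
    _ = (t : ℝ) / d := by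
      rw [div_pow, Real.sq_sqrt (by positivity), one_pow, one_div_div]

theorem schedule_weight_mem {d R : ℕ} {a : ℕ × ℝ} (ha : a ∈ schedule d R) :
    0 ≤ a.2 ∧ a.2 ≤ 1 := by
  rcases List.mem_append.1 ha with h | h
  · obtain ⟨t, ht, rfl⟩ := List.mem_map.1 h
    have htd : t < d := (List.mem_range.1 ht).trans_le (min_le_right _ _)
    have hd' : (0 : ℝ) < d := Nat.cast_pos.2 (by omega)
    refine ⟨by simp only [exactWeight]; positivity, ?_⟩
    have := sin_exactAngle_le (d := d) (t := t + 1) (by omega) (by omega)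
    calc exactWeight d (t + 1) ≤ (d : ℝ) / (t + 1 : ℕ) * (((t + 1 : ℕ) : ℝ) / d) := by
          unfold exactWeight; gcongr
      _ = 1 := by
          have : ((t + 1 : ℕ) : ℝ) ≠ 0 := by positivity
          field_simp
  · obtain ⟨l, hl, hal⟩ := List.mem_flatten.1 h
    rw [List.eq_of_mem_replicate hl] at hal
    obtain ⟨j, -, rfl⟩ := List.mem_map.1 hal
    simp

theorem attemptFailure_exact {d t : ℕ} (hd : 0 < d) (ht : 0 < t) :
    attemptFailure d t (exactRounds d t, exactWeight d t) = 0 := by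
  have hd' : (d : ℝ) ≠ 0 := by positivity
  have ht' : (t : ℝ) ≠ 0 := by positivity
  obtain ⟨h0, h1⟩ := exactAngle_mem d t
  have hw : exactWeight d t * t / d =
      Real.sin (Real.pi / (2 * (2 * exactRounds d t + 1))) ^ 2 := by
    unfold exactWeight; field_simp
  have hk : (2 * (exactRounds d t : ℝ) + 1) ≠ 0 := by positivity
  have hang : (2 * (exactRounds d t : ℝ) + 1) *
      (Real.pi / (2 * (2 * exactRounds d t + 1))) = Real.pi / 2 := by
    field_simp
  unfold attemptFailure
  rw [hw, Real.sqrt_sq (Real.sin_nonneg_of_nonneg_of_le_pi h0.le (by linarith [Real.pi_pos])),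
    Real.arcsin_sin (by linarith [Real.pi_pos]) h1, hang, Real.cos_pi_div_two]
  norm_num

/-- Repeated tripling brings every angle into the range where the sine is at least `1 / 2`. -/
theorem exists_tripling (θ : ℝ) (h0 : 0 < θ) (h1 : θ ≤ Real.pi / 2) :
    ∃ j : ℕ, (3 : ℝ) ^ j * θ ≤ Real.pi / 2 ∧ Real.cos ((3 : ℝ) ^ j * θ) ^ 2 ≤ 3 / 4 := by
  have hex : ∃ j : ℕ, Real.pi / 2 < (3 : ℝ) ^ j * θ := by
    obtain ⟨j, hj⟩ := pow_unbounded_of_one_lt (Real.pi / 2 / θ) (by norm_num : (1 : ℝ) < 3)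
    exact ⟨j, by rwa [div_lt_iff₀ h0] at hj⟩
  classical
  have hpos : Nat.find hex ≠ 0 := fun h => by
    have := Nat.find_spec hex
    rw [h] at this
    linarith
  obtain ⟨j, hj⟩ := Nat.exists_eq_succ_of_ne_zero hpos
  have hle : (3 : ℝ) ^ j * θ ≤ Real.pi / 2 :=
    not_lt.1 (Nat.find_min hex (by omega : j < Nat.find hex))
  have hlt : Real.pi / 2 < (3 : ℝ) ^ (j + 1) * θ := by
    have := Nat.find_spec hex
    rwa [hj] at this
  refine ⟨j, hle, ?_⟩
  have hsin : 1 / 2 ≤ Real.sin ((3 : ℝ) ^ j * θ) := by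
    rw [← Real.sin_pi_div_six]
    apply Real.sin_le_sin_of_le_of_le_pi_div_two _ hle
    · rw [pow_succ] at hlt; linarith
    · linarith [Real.pi_pos]
  rw [Real.cos_sq']
  nlinarith

theorem two_mul_div_two_pow_three (j : ℕ) : 2 * ((3 ^ j - 1) / 2) + 1 = 3 ^ j := by
  have h : (3 ^ j) % 2 = 1 := by
    rw [Nat.pow_mod]; simp
  generalize 3 ^ j = m at h ⊢
  omega

theorem exists_mem_tripling {d R τ : ℕ} (hR : 0 < R) (hRτ : R ≤ τ) (hτd : τ ≤ d) :
    ∃ j ∈ tripling d R, attemptFailure d τ ((3 ^ j - 1) / 2, 1) ≤ 3 / 4 := by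
  have hR' : (1 : ℝ) ≤ R := by exact_mod_cast hR
  have hτ' : (R : ℝ) ≤ τ := by exact_mod_cast hRτ
  have hd' : (τ : ℝ) ≤ d := by exact_mod_cast hτd
  have hτ0 : (0 : ℝ) < τ := by linarith
  have hd0 : (0 : ℝ) < d := by linarith
  have hs0 : 0 < √((τ : ℝ) / d) := Real.sqrt_pos.2 (by positivity)
  have hs1 : √((τ : ℝ) / d) ≤ 1 := Real.sqrt_le_one.2 ((div_le_one hd0).2 hd')
  obtain ⟨j, hj, hcos⟩ := exists_tripling (Real.arcsin √((τ : ℝ) / d)) (Real.arcsin_pos.2 hs0)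
    (Real.arcsin_le_pi_div_two _)
  have hsle : √((τ : ℝ) / d) ≤ Real.arcsin √((τ : ℝ) / d) := by
    conv_lhs => rw [← Real.sin_arcsin (by linarith) hs1]
    exact Real.sin_le (Real.arcsin_nonneg.2 hs0.le)
  have hinv : √((τ : ℝ) / d) * √((d : ℝ) / τ) = 1 := by
    rw [← Real.sqrt_mul (by positivity), div_mul_div_cancel₀ hd0.ne', div_self hτ0.ne',
      Real.sqrt_one]
  have hpow : (3 : ℝ) ^ j ≤ 2 * √((d : ℝ) / R) := by
    have h2 : (3 : ℝ) ^ j * √((τ : ℝ) / d) ≤ 2 := by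
      have := mul_le_mul_of_nonneg_left hsle (by positivity : (0 : ℝ) ≤ 3 ^ j)
      linarith [Real.pi_lt_four]
    calc (3 : ℝ) ^ j = (3 : ℝ) ^ j * √((τ : ℝ) / d) * √((d : ℝ) / τ) := by
          rw [mul_assoc, hinv, mul_one]
      _ ≤ 2 * √((d : ℝ) / τ) := by gcongr
      _ ≤ 2 * √((d : ℝ) / R) := by gcongr
  refine ⟨j, ?_, ?_⟩
  · rw [tripling, List.mem_filter, List.mem_range]
    refine ⟨?_, by simpa using hpow⟩
    have h3 : √((d : ℝ) / R) ≤ d := by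
      have h1d : (1 : ℝ) ≤ d := by linarith
      rw [Real.sqrt_le_left hd0.le]
      calc (d : ℝ) / R ≤ d := div_le_self hd0.le hR'
        _ ≤ (d : ℝ) ^ 2 := by nlinarith
    have h4 : 3 ^ j ≤ 2 * d := by
      have : (3 : ℝ) ^ j ≤ 2 * d := by linarith
      exact_mod_cast this
    have : j < 3 ^ j := Nat.lt_pow_self (by norm_num)
    omega
  · have hcast : (2 * (((3 ^ j - 1) / 2 : ℕ) : ℝ) + 1) = 3 ^ j := by
      exact_mod_cast two_mul_div_two_pow_three j
    simp only [attemptFailure, one_mul, hcast]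
    exact hcos

/-- The schedule finds a marked item, if there is one, except with probability exponentially small
in `R`. -/
theorem prod_attemptFailure_schedule_le {d R τ : ℕ} (hR : 0 < R) (hτ : 0 < τ) (hτd : τ ≤ d) :
    ((schedule d R).map (attemptFailure d τ)).prod ≤ (3 / 4) ^ R := by
  rw [schedule, List.map_append, List.prod_append]
  rcases le_or_gt τ R with h | h
  · have hmem : (exactRounds d τ, exactWeight d τ) ∈ exactSchedule d R := by
      refine List.mem_map.2 ⟨τ - 1, List.mem_range.2 (lt_min (by omega) (by omega)), ?_⟩
      rw [Nat.sub_add_cancel hτ]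
    have h0 := prod_map_attemptFailure_le_of_mem d τ hmem
    rw [attemptFailure_exact (by omega) hτ] at h0
    rw [le_antisymm h0 (prod_map_attemptFailure_nonneg _ _ _), zero_mul]
    positivity
  · obtain ⟨j, hj, hfail⟩ := exists_mem_tripling hR h.le hτd
    have h1 := prod_map_attemptFailure_le_of_mem d τ
      (List.mem_map_of_mem (f := fun j => ((3 ^ j - 1) / 2, (1 : ℝ))) hj)
    refine (mul_le_of_le_one_left (prod_map_attemptFailure_nonneg _ _ _)
      (prod_map_attemptFailure_le_one _ _ _)).trans ?_
    rw [triplingSchedule, List.map_flatten, List.prod_flatten, List.map_replicate,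
      List.map_replicate, List.prod_replicate]
    exact pow_le_pow_left₀ (prod_map_attemptFailure_nonneg _ _ _) (h1.trans hfail) R

/-! ### The number of queries of the schedule -/

/-- The number of queries of an attempt with `a.1` rounds. -/
def attemptQueries (a : ℕ × ℝ) : ℕ := 4 * a.1 + 2

theorem sum_one_div_sqrt_le (M : ℕ) :
    ((List.range M).map fun t => 1 / √((t + 1 : ℕ) : ℝ)).sum ≤ 2 * √(M : ℝ) := by
  induction M with
  | zero => simp
  | succ M ih =>
    rw [List.range_succ, List.map_append, List.sum_append]
    simp only [List.map_cons, List.map_nil, List.sum_cons, List.sum_nil, add_zero]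
    have hp : 0 < √((M + 1 : ℕ) : ℝ) := Real.sqrt_pos.2 (by positivity)
    have h1 : √((M + 1 : ℕ) : ℝ) ^ 2 = M + 1 := by rw [Real.sq_sqrt (by positivity)]; push_cast; ring
    have h2 : √(M : ℝ) ^ 2 = M := Real.sq_sqrt (by positivity)
    have h3 : 1 / √((M + 1 : ℕ) : ℝ) ≤ 2 * (√((M + 1 : ℕ) : ℝ) - √(M : ℝ)) := by
      rw [div_le_iff₀ hp]
      nlinarith [sq_nonneg (√((M + 1 : ℕ) : ℝ) - √(M : ℝ))]
    linarith

theorem sum_queries_exactSchedule_le (d R : ℕ) :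
    (((exactSchedule d R).map attemptQueries).sum : ℝ) ≤ 20 * √((d : ℝ) * R) := by
  have hterm : ∀ t ∈ List.range (min R d),
      (attemptQueries (exactRounds d (t + 1), exactWeight d (t + 1)) : ℝ) ≤
        10 * √(d : ℝ) * (1 / √((t + 1 : ℕ) : ℝ)) := by
    intro t ht
    have htd : t + 1 ≤ d := (List.mem_range.1 ht).trans_le (min_le_right _ _)
    have htd' : ((t + 1 : ℕ) : ℝ) ≤ d := by exact_mod_cast htd
    have hc : (exactRounds d (t + 1) : ℝ) < √((d : ℝ) / (t + 1 : ℕ)) + 1 :=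
      Nat.ceil_lt_add_one (Real.sqrt_nonneg _)
    have h1 : 1 ≤ √((d : ℝ) / (t + 1 : ℕ)) := by
      rw [Real.one_le_sqrt, one_le_div (by positivity)]
      exact htd'
    have h2 : 10 * √(d : ℝ) * (1 / √((t + 1 : ℕ) : ℝ)) = 10 * √((d : ℝ) / (t + 1 : ℕ)) := by
      rw [Real.sqrt_div (by positivity)]; ring
    rw [h2]
    simp only [attemptQueries]
    push_cast at *
    linarith
  calc (((exactSchedule d R).map attemptQueries).sum : ℝ)
      = ((List.range (min R d)).map fun t =>
          (attemptQueries (exactRounds d (t + 1), exactWeight d (t + 1)) : ℝ)).sum := by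
        rw [exactSchedule, List.map_map, Nat.cast_list_sum, List.map_map]; rfl
    _ ≤ ((List.range (min R d)).map fun t => 10 * √(d : ℝ) * (1 / √((t + 1 : ℕ) : ℝ))).sum :=
        List.sum_le_sum hterm
    _ = 10 * √(d : ℝ) * ((List.range (min R d)).map fun t => 1 / √((t + 1 : ℕ) : ℝ)).sum := by
        rw [List.sum_map_mul_left]
    _ ≤ 10 * √(d : ℝ) * (2 * √((min R d : ℕ) : ℝ)) := by
        gcongr; exact sum_one_div_sqrt_le _
    _ ≤ 10 * √(d : ℝ) * (2 * √(R : ℝ)) := by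
        gcongr; exact min_le_left _ _
    _ = 20 * √((d : ℝ) * R) := by rw [Real.sqrt_mul (by positivity)]; ring

theorem sum_pow_three_filter_le (y : ℝ) (hy : 0 ≤ y) (M : ℕ) :
    (((List.range M).filter fun j => (3 : ℝ) ^ j ≤ y).map fun j => (3 : ℝ) ^ j).sum ≤
      3 / 2 * y := by
  induction M with
  | zero => simp; positivity
  | succ M ih =>
    by_cases h : (3 : ℝ) ^ M ≤ y
    · have hall : (((List.range (M + 1)).filter fun j => (3 : ℝ) ^ j ≤ y)) = List.range (M + 1) := by
        refine List.filter_eq_self.2 fun j hj => ?_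
        have : (3 : ℝ) ^ j ≤ 3 ^ M :=
          pow_le_pow_right₀ (by norm_num) (by have := List.mem_range.1 hj; omega)
        simpa using this.trans h
      have hgeo : ∀ K : ℕ, ((List.range (K + 1)).map fun j => (3 : ℝ) ^ j).sum ≤ 3 / 2 * 3 ^ K := by
        intro K
        induction K with
        | zero => norm_num
        | succ K ihK =>
          rw [List.range_succ, List.map_append, List.sum_append]
          simp only [List.map_cons, List.map_nil, List.sum_cons, List.sum_nil, add_zero]
          rw [pow_succ]
          linarith [pow_pos (by norm_num : (0 : ℝ) < 3) K]
      rw [hall]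
      linarith [hgeo M]
    · rw [List.range_succ, List.filter_append, List.map_append, List.sum_append]
      simpa [h] using ih

theorem sum_queries_triplingSchedule_le (d R : ℕ) :
    (((triplingSchedule d R).map attemptQueries).sum : ℝ) ≤ 6 * √((d : ℝ) * R) := by
  have hsum : ((((tripling d R).map fun j => ((3 ^ j - 1) / 2, (1 : ℝ))).map attemptQueries).sum : ℝ)
      = 2 * ((tripling d R).map fun j => (3 : ℝ) ^ j).sum := by
    rw [List.map_map, Nat.cast_list_sum, List.map_map, ← List.sum_map_mul_left]
    congr 1
    refine List.map_congr_left fun j _ => ?_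
    have h : attemptQueries ((3 ^ j - 1) / 2, (1 : ℝ)) = 2 * 3 ^ j := by
      have := two_mul_div_two_pow_three j
      simp only [attemptQueries]; omega
    simp [h]
  have hle := sum_pow_three_filter_le (2 * √((d : ℝ) / R)) (by positivity) (2 * d + 1)
  rw [triplingSchedule, List.map_flatten, List.sum_flatten, List.map_replicate,
    List.map_replicate, List.sum_replicate, nsmul_eq_mul, Nat.cast_mul, hsum]
  have hR : (R : ℝ) * √((d : ℝ) / R) = √((d : ℝ) * R) := by
    rcases Nat.eq_zero_or_pos R with rfl | h
    · simp
    · have hR0 : (0 : ℝ) < R := by exact_mod_cast h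
      rw [← Real.sqrt_sq (Nat.cast_nonneg R : (0 : ℝ) ≤ R), ← Real.sqrt_mul (by positivity),
        Real.sqrt_sq hR0.le]
      congr 1
      field_simp
  calc (R : ℝ) * (2 * ((tripling d R).map fun j => (3 : ℝ) ^ j).sum)
      ≤ R * (2 * (3 / 2 * (2 * √((d : ℝ) / R)))) := by gcongr; exact hle
    _ = 6 * (R * √((d : ℝ) / R)) := by ring
    _ = 6 * √((d : ℝ) * R) := by rw [hR]

theorem sum_queries_schedule_le (d R : ℕ) :
    (((schedule d R).map attemptQueries).sum : ℝ) ≤ 26 * √((d : ℝ) * R) := by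
  rw [schedule, List.map_append, List.sum_append, Nat.cast_add]
  linarith [sum_queries_exactSchedule_le d R, sum_queries_triplingSchedule_le d R]

/-! ### Composing query algorithms -/

section Control

variable {A R : Type} [Fintype A] [DecidableEq A] [Fintype R] [DecidableEq R] [AddGroup R]

/-- The circuit that makes one query to a fixed address. -/
def classicalQuery (A : Type) (R : Type) [Fintype A] [DecidableEq A] [Fintype R] [DecidableEq R]
    [AddGroup R] (a : A) : QueryCircuit A R where
  W := Unit
  init := (a, 0, ())
  queries := 1
  U _ := LinearIsometryEquiv.refl ℂ _

theorem classicalQuery_measure (x : A → R) (a : A) :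
    (classicalQuery A R a).measure x = PMF.pure (a, x a, ()) := by
  have hs : ∀ z : A × R × Unit, ENNReal.ofReal (‖(EuclideanSpace.single (a, (0 : R), ()) (1 : ℂ))
      ((QueryCircuit.oraclePerm Unit x).symm z)‖ ^ 2) = PMF.pure (a, x a, ()) z := by
    intro z
    have hiff : (QueryCircuit.oraclePerm Unit x).symm z = (a, 0, ()) ↔ z = (a, x a, ()) := by
      rw [Equiv.symm_apply_eq]
      simp [QueryCircuit.oraclePerm]
    rw [PiLp.single_apply, PMF.pure_apply]
    by_cases hz : z = (a, x a, ())
    · rw [if_pos (hiff.2 hz), if_pos hz]; simp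
    · rw [if_neg (mt hiff.1 hz), if_neg hz]; simp
  ext z
  exact hs z

/-- Query the address `a` and continue depending on the answer. -/
def QueryAlg.ask {α : Type} (a : A) (next : R → QueryAlg A R α) : QueryAlg A R α :=
  .run (classicalQuery A R a) fun z => next z.2.1

theorem QueryAlg.exec_ask {α : Type} (x : A → R) (a : A) (next : R → QueryAlg A R α) :
    (QueryAlg.ask a next).exec x = ((next (x a)).exec x).map fun s => (s.1, 1 + s.2) := by
  rw [QueryAlg.ask, QueryAlg.exec, classicalQuery_measure]
  exact PMF.pure_bind _ _

/-- Run the circuits of a list of attempts until the outcome of one of them is accepted. The result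
is `yes` if this happens and its negation otherwise. -/
def QueryAlg.tryAll {ι : Type} (c : ι → QueryCircuit A R)
    (acc : ∀ i, A × R × (c i).W → Bool) (yes : Bool) : List ι → QueryAlg A R Bool
  | [] => .ret (!yes)
  | i :: l => .run (c i) fun z => if acc i z then .ret yes else QueryAlg.tryAll c acc yes l

theorem QueryAlg.tryAll_queries_le {ι : Type} (c : ι → QueryCircuit A R)
    (acc : ∀ i, A × R × (c i).W → Bool) (yes : Bool) (x : A → R) (l : List ι) :
    ∀ s ∈ ((QueryAlg.tryAll c acc yes l).exec x).support,
      s.2 ≤ (l.map fun i => (c i).queries).sum := by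
  induction l with
  | nil => simp [QueryAlg.tryAll, QueryAlg.exec]
  | cons i l ih =>
    intro s hs
    rw [QueryAlg.tryAll, QueryAlg.exec, PMF.mem_support_bind_iff] at hs
    obtain ⟨z, -, hz⟩ := hs
    rw [PMF.support_map] at hz
    obtain ⟨r, hr, rfl⟩ := hz
    rw [List.map_cons, List.sum_cons]
    by_cases h : acc i z
    · rw [if_pos h] at hr
      simp [QueryAlg.exec] at hr
      simp [hr]
    · rw [if_neg h] at hr
      have := ih r hr
      simpa using this

theorem QueryAlg.tryAll_failure {ι : Type} (c : ι → QueryCircuit A R)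
    (acc : ∀ i, A × R × (c i).W → Bool) (yes : Bool) (x : A → R) (l : List ι) :
    ((QueryAlg.tryAll c acc yes l).exec x).toOuterMeasure {s | s.1 = !yes} =
      (l.map fun i => ∑ z, if acc i z then 0 else (c i).measure x z).prod := by
  induction l with
  | nil => simp [QueryAlg.tryAll, QueryAlg.exec, PMF.toOuterMeasure_pure_apply]
  | cons i l ih =>
    rw [QueryAlg.tryAll, QueryAlg.exec, PMF.toOuterMeasure_bind_apply, tsum_fintype, List.map_cons,
      List.prod_cons, Finset.sum_mul]
    refine Finset.sum_congr rfl fun z _ => ?_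
    rw [PMF.toOuterMeasure_map_apply]
    by_cases h : acc i z
    · rw [if_pos h, if_pos h, QueryAlg.exec, PMF.toOuterMeasure_pure_apply]
      simp
    · rw [if_neg h, if_neg h, ← ih]
      rfl

end Control

/-! ### The search for a neighbour with a given value -/

section Search

variable {N L : ℕ}

/-- The address of the value of the vertex named by an answer; an answer that names no vertex is
sent to an arbitrary address, the degree of `i`. -/
def valueAddr (i : Fin (N + L)) (y : Ans N L) : Addr N L :=
  if h : y.val < N + L then .val ⟨y.val, h⟩ else .deg i

/-- The idle basis state of the search at vertex `i`. -/
def idleState (i : Fin (N + L)) : Addr N L × Ans N L × (Addr N L × Ans N L) :=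
  (.deg i, 0, (.deg i, 0))

/-- The basis state of the search that stands for entry `p` of the adjacency list. -/
def entryState (i p : Fin (N + L)) : Addr N L × Ans N L × (Addr N L × Ans N L) :=
  (.nbr i p, 0, (.deg i, 0))

/-- Between its two queries, the search moves the first address and its answer to the workspace and
takes the address of the value of the vertex named by that answer. A transposition, which depends
on the answer, makes this reversible. -/
def lookupPerm (i : Fin (N + L)) :
    Equiv.Perm (Addr N L × Ans N L × (Addr N L × Ans N L)) where
  toFun z := (Equiv.swap (.deg i) (valueAddr i z.2.1) z.2.2.1, z.2.2.2, (z.1, z.2.1))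
  invFun z := (z.2.2.1, z.2.2.2, (Equiv.swap (.deg i) (valueAddr i z.2.2.2) z.1, z.2.1))
  left_inv z := by simp
  right_inv z := by simp

/-- After the two queries the value `b` has been read, starting from an entry of the adjacency
list. -/
def foundFlag (i : Fin (N + L)) (b : Bool)
    (z : Addr N L × Ans N L × (Addr N L × Ans N L)) : Bool :=
  decide (z.2.2.1 ≠ .deg i ∧ z.2.1 = if b then 1 else 0)

/-- The value read at entry `p` of the adjacency list is `b`. -/
def Marked (x : Addr N L → Ans N L) (i : Fin (N + L)) (b : Bool) (p : Fin (N + L)) : Prop :=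
  x (valueAddr i (x (.nbr i p))) = if b then 1 else 0

theorem foundFlag_idleState (x : Addr N L → Ans N L) (i : Fin (N + L)) (b : Bool) :
    foundFlag i b (twoQueryPerm (lookupPerm i) x (idleState i)) = false := by
  simp [foundFlag, twoQueryPerm, lookupPerm, idleState, QueryCircuit.oraclePerm]

theorem foundFlag_entryState (x : Addr N L → Ans N L) (i : Fin (N + L)) (b : Bool)
    (p : Fin (N + L)) :
    foundFlag i b (twoQueryPerm (lookupPerm i) x (entryState i p)) = true ↔ Marked x i b p := by
  simp [foundFlag, twoQueryPerm, lookupPerm, entryState, QueryCircuit.oraclePerm, Marked]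

/-- The distribution that gives total weight `μ` to the first `d` entries of the adjacency list, and
the rest to the idle state. -/
def searchDist (i : Fin (N + L)) (d : ℕ) (μ : ℝ)
    (z : Addr N L × Ans N L × (Addr N L × Ans N L)) : ℝ :=
  (if z = idleState i then 1 - μ else 0) +
    ∑ p : Fin (N + L), if z = entryState i p then (if (p : ℕ) < d then μ / d else 0) else 0

theorem sum_searchDist (i : Fin (N + L)) (d : ℕ) (μ : ℝ)
    (F : Addr N L × Ans N L × (Addr N L × Ans N L) → ℝ) :
    ∑ z, F z * searchDist i d μ z = F (idleState i) * (1 - μ) +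
      ∑ p : Fin (N + L), F (entryState i p) * (if (p : ℕ) < d then μ / d else 0) := by
  simp only [searchDist, mul_add, Finset.sum_add_distrib, Finset.mul_sum, mul_ite, mul_zero]
  rw [Finset.sum_comm]
  simp [Finset.sum_ite_eq']

theorem card_filter_val_lt {n d : ℕ} (hd : d ≤ n) :
    (Finset.univ.filter fun p : Fin n => (p : ℕ) < d).card = d := by
  rw [Fin.card_filter_val_lt, min_eq_right hd]

theorem exists_searchPrep (i : Fin (N + L)) {d : ℕ} (hd0 : 0 < d) (hd : d ≤ N + L) {μ : ℝ}
    (hμ0 : 0 ≤ μ) (hμ1 : μ ≤ 1) :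
    ∃ P : EuclideanSpace ℂ (Addr N L × Ans N L × (Addr N L × Ans N L)) ≃ₗᵢ[ℂ]
        EuclideanSpace ℂ (Addr N L × Ans N L × (Addr N L × Ans N L)),
      ∀ z, ‖P (EuclideanSpace.single (idleState i) 1) z‖ ^ 2 = searchDist i d μ z := by
  refine exists_unitary_norm_sq_eq _ _ (fun z => ?_) ?_
  · refine add_nonneg ?_ (Finset.sum_nonneg fun p _ => ?_) <;> split_ifs <;> positivity
  · have h := sum_searchDist i d μ fun _ => 1
    have hd' : (d : ℝ) ≠ 0 := by positivity
    simp only [one_mul] at h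
    rw [h, ← Finset.sum_filter, Finset.sum_const, card_filter_val_lt hd, nsmul_eq_mul]
    field_simp
    ring

open scoped Classical in
/-- A unitary that prepares, from the idle state, a state with the distribution `searchDist`. It is
only used where there is one. -/
def searchPrep (i : Fin (N + L)) (d : ℕ) (μ : ℝ) :
    EuclideanSpace ℂ (Addr N L × Ans N L × (Addr N L × Ans N L)) ≃ₗᵢ[ℂ]
      EuclideanSpace ℂ (Addr N L × Ans N L × (Addr N L × Ans N L)) :=
  if h : ∃ P : EuclideanSpace ℂ (Addr N L × Ans N L × (Addr N L × Ans N L)) ≃ₗᵢ[ℂ]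
        EuclideanSpace ℂ (Addr N L × Ans N L × (Addr N L × Ans N L)),
      ∀ z, ‖P (EuclideanSpace.single (idleState i) 1) z‖ ^ 2 = searchDist i d μ z
  then h.choose else LinearIsometryEquiv.refl ℂ _

theorem norm_sq_searchPrep (i : Fin (N + L)) {d : ℕ} (hd0 : 0 < d) (hd : d ≤ N + L) {μ : ℝ}
    (hμ0 : 0 ≤ μ) (hμ1 : μ ≤ 1) (z : Addr N L × Ans N L × (Addr N L × Ans N L)) :
    ‖searchPrep i d μ (EuclideanSpace.single (idleState i) 1) z‖ ^ 2 = searchDist i d μ z := by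
  have h := exists_searchPrep i hd0 hd hμ0 hμ1
  rw [searchPrep, dif_pos h]
  exact h.choose_spec z

/-- One attempt at finding an entry with value `b` among the first `d` entries of the adjacency list
of `i`, with `a.1` rounds and the weight `a.2` in the prepared state. -/
def searchAttempt (i : Fin (N + L)) (d : ℕ) (b : Bool) (a : ℕ × ℝ) :
    QueryCircuit (Addr N L) (Ans N L) :=
  amplification (idleState i) (searchPrep i d a.2) (lookupPerm i) (foundFlag i b) a.1

open scoped Classical in
theorem searchAttempt_failure (x : Addr N L → Ans N L) (i : Fin (N + L)) {d : ℕ} (b : Bool)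
    (hd0 : 0 < d) (hd : d ≤ N + L) (a : ℕ × ℝ) (hμ0 : 0 ≤ a.2) (hμ1 : a.2 ≤ 1) (θ : ℝ)
    (hθ : a.2 * (Finset.univ.filter fun p : Fin (N + L) => (p : ℕ) < d ∧ Marked x i b p).card / d =
      Real.sin θ ^ 2) :
    ∑ z : Addr N L × Ans N L × (Addr N L × Ans N L),
      (if foundFlag i b (negPerm _ _ _ z) then 0 else (searchAttempt i d b a).measure x z) =
      ENNReal.ofReal (Real.cos ((2 * a.1 + 1) * θ) ^ 2) := by
  refine amplification_failure (idleState i) (searchPrep i d a.2) (lookupPerm i) (foundFlag i b) x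
    θ ?_ a.1
  have h := sum_searchDist i d a.2 fun z =>
    if foundFlag i b (twoQueryPerm (lookupPerm i) x z) then 1 else 0
  simp only [ite_mul, one_mul, zero_mul, foundFlag_idleState, foundFlag_entryState,
    Bool.false_eq_true, if_false, zero_add] at h
  simp only [norm_sq_searchPrep i hd0 hd hμ0 hμ1]
  rw [h, ← hθ, ← Finset.sum_filter, ← Finset.sum_filter, Finset.filter_filter, Finset.sum_const,
    nsmul_eq_mul]
  simp only [and_comm]
  ring

end Search

/-! ### Processing one vertex -/

section Vertex

variable {N L : ℕ}

/-- The algorithm that evaluates the non-sink `i`. The answers to the first two queries are the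
degree and the code of the transition function; a neighbour with value `false` decides AND and
NAND, and a neighbour with value `true` decides OR. -/
def vertexAlg (R : ℕ) (i : Fin N) : QueryAlg (Addr N L) (Ans N L) Bool :=
  .ask (.deg (Fin.castAdd L i)) fun y => .ask (.op i) fun o =>
    .tryAll (searchAttempt (Fin.castAdd L i) y.val (decide (o = 1)))
      (fun _ z => foundFlag (Fin.castAdd L i) (decide (o = 1)) (negPerm _ _ _ z))
      (decide (o ≠ 0)) (schedule y.val R)

theorem ans_cast_val {k : ℕ} (hk : k < N + L + 3) : ((k : ℕ) : Ans N L).val = k :=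
  ZMod.val_natCast_of_lt hk

theorem ans_cast_inj {k l : ℕ} (hk : k < N + L + 3) (hl : l < N + L + 3) :
    ((k : ℕ) : Ans N L) = (l : ℕ) ↔ k = l := by
  refine ⟨fun h => ?_, fun h => by rw [h]⟩
  rw [← ans_cast_val hk, h, ans_cast_val hl]

/-- The value of a single argument that decides the value of the transition function. -/
def BoolOp.decisive : BoolOp → Bool
  | .and => false
  | .or => true
  | .nand => false

/-- The value of the transition function if an argument has the decisive value. -/
def BoolOp.decided : BoolOp → Bool
  | .and => false
  | .or => true
  | .nand => true

theorem BoolOp.eval_eq_decided_iff (h : BoolOp) {α : Type} (l : List α) (f : α → Bool) :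
    h.eval (l.map f) = h.decided ↔ ∃ a ∈ l, f a = h.decisive := by
  cases h <;> simp [BoolOp.eval, BoolOp.decided, BoolOp.decisive]

theorem decide_code_eq_one (h : BoolOp) : decide (((h.code : ℕ) : Ans N L) = 1) = h.decisive := by
  rw [← Nat.cast_one]
  simp only [ans_cast_inj (N := N) (L := L) (k := h.code) (l := 1)
    (by cases h <;> simp [BoolOp.code]) (by omega)]
  cases h <;> simp [BoolOp.code, BoolOp.decisive]

theorem decide_code_ne_zero (h : BoolOp) :
    decide (((h.code : ℕ) : Ans N L) ≠ 0) = h.decided := by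
  rw [← Nat.cast_zero]
  simp only [ne_eq, ans_cast_inj (N := N) (L := L) (k := h.code) (l := 0)
    (by cases h <;> simp [BoolOp.code]) (by omega)]
  cases h <;> simp [BoolOp.code, BoolOp.decided]

theorem SortedDAG.length_le (G : SortedDAG N L) (v : Fin (N + L)) : (G.D v).length ≤ N + L := by
  simpa using (G.nodup v).length_le_card

theorem blackBox_deg_val (P : BoolDP N L) (t : Fin N → Bool) (v : Fin (N + L)) :
    (P.blackBox t (.deg v)).val = (P.G.D v).length :=
  ans_cast_val (by have := P.G.length_le v; omega)

theorem tf_eq (P : BoolDP N L) (t : Fin N → Bool) (i : Fin N)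
    (ht : ∀ j, i < j → t j = P.f (Fin.castAdd L j)) (v : Fin (N + L)) (hv : Fin.castAdd L i < v) :
    P.tf t v = P.f v := by
  induction v using Fin.addCases with
  | left j => simpa [BoolDP.tf] using ht j ((Fin.strictMono_castAdd L).lt_iff_lt.1 hv)
  | right j => simp [BoolDP.tf]

theorem marked_iff (P : BoolDP N L) (t : Fin N → Bool) (i : Fin N)
    (ht : ∀ j, i < j → t j = P.f (Fin.castAdd L j)) (b : Bool) (p : Fin (N + L))
    (hp : (p : ℕ) < (P.G.D (Fin.castAdd L i)).length) :
    Marked (P.blackBox t) (Fin.castAdd L i) b p ↔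
      P.f (P.G.D (Fin.castAdd L i))[(p : ℕ)] = b := by
  have hval : valueAddr (Fin.castAdd L i) (P.blackBox t (.nbr (Fin.castAdd L i) p)) =
      .val (P.G.D (Fin.castAdd L i))[(p : ℕ)] := by
    have hv : (P.blackBox t (.nbr (Fin.castAdd L i) p)).val =
        ((P.G.D (Fin.castAdd L i))[(p : ℕ)] : ℕ) := by
      simp only [BoolDP.blackBox, dif_pos hp]
      exact ans_cast_val (by have := (P.G.D (Fin.castAdd L i))[(p : ℕ)].2; omega)
    simp only [valueAddr, hv, Fin.is_lt, dif_pos, Fin.eta]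
  have h10 : (1 : Ans N L) ≠ 0 := by
    intro h
    rw [← Nat.cast_one, ← Nat.cast_zero, ans_cast_inj (by omega) (by omega)] at h
    omega
  rw [Marked, hval, ← tf_eq P t i ht _ (P.G.sorted _ _ (List.getElem_mem hp))]
  simp only [BoolDP.blackBox]
  cases P.tf t _ <;> cases b <;> simp [h10, h10.symm]

/-- The algorithm at vertex `i`, on the black box of an instance: two queries determine the degree
and the transition function, and a search follows. -/
theorem vertexAlg_exec (R : ℕ) (P : BoolDP N L) (t : Fin N → Bool) (i : Fin N) :
    (vertexAlg R i).exec (P.blackBox t) =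
      ((QueryAlg.tryAll
        (searchAttempt (Fin.castAdd L i) (P.G.D (Fin.castAdd L i)).length (P.h i).decisive)
        (fun _ z => foundFlag (Fin.castAdd L i) (P.h i).decisive (negPerm _ _ _ z))
        (P.h i).decided (schedule (P.G.D (Fin.castAdd L i)).length R)).exec
          (P.blackBox t)).map fun s => (s.1, 2 + s.2) := by
  have hop : P.blackBox t (.op i) = (((P.h i).code : ℕ) : Ans N L) := rfl
  rw [vertexAlg, QueryAlg.exec_ask, QueryAlg.exec_ask, blackBox_deg_val, hop, decide_code_eq_one,
    decide_code_ne_zero, PMF.map_comp]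
  congr 1
  funext s
  simp [← add_assoc]

theorem vertexAlg_queries_le (R : ℕ) (P : BoolDP N L) (t : Fin N → Bool) (i : Fin N) :
    ∀ s ∈ ((vertexAlg R i).exec (P.blackBox t)).support,
      s.2 ≤ 2 + ((schedule (P.G.D (Fin.castAdd L i)).length R).map attemptQueries).sum := by
  intro s hs
  rw [vertexAlg_exec, PMF.support_map] at hs
  obtain ⟨r, hr, rfl⟩ := hs
  exact Nat.add_le_add_left (QueryAlg.tryAll_queries_le _ _ _ _ _ r hr) 2

theorem PMF.toOuterMeasure_ne_eq_zero {α : Type} (p : PMF (Bool × α)) (b : Bool)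
    (h : p.toOuterMeasure {s | s.1 = b} = 1) : p.toOuterMeasure {s | s.1 ≠ b} = 0 := by
  rw [PMF.toOuterMeasure_apply_eq_one_iff] at h
  rw [PMF.toOuterMeasure_apply_eq_zero_iff, Set.disjoint_left]
  exact fun s hs hne => hne (h hs)

/-- If the values stored for the later vertices are correct, then so is the result at `i`, except
with probability `(3 / 4) ^ R`. -/
theorem vertexAlg_error_le {R : ℕ} (hR : 0 < R) (P : BoolDP N L) (t : Fin N → Bool) (i : Fin N)
    (ht : ∀ j, i < j → t j = P.f (Fin.castAdd L j)) :
    ((vertexAlg R i).exec (P.blackBox t)).toOuterMeasure {s | s.1 ≠ P.f (Fin.castAdd L i)} ≤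
      ENNReal.ofReal ((3 / 4) ^ R) := by
  classical
  set v := Fin.castAdd L i with hv
  set d := (P.G.D v).length with hd
  set b := (P.h i).decisive with hb
  set τ := (Finset.univ.filter fun p : Fin (N + L) =>
    (p : ℕ) < d ∧ Marked (P.blackBox t) v b p).card with hτ
  have hd0 : 0 < d := List.length_pos_iff.2 (P.G.nonsink i)
  have hdn : d ≤ N + L := P.G.length_le v
  have hτd : τ ≤ d := by
    calc τ ≤ (Finset.univ.filter fun p : Fin (N + L) => (p : ℕ) < d).card :=
          Finset.card_le_card fun p hp => by
            simp only [Finset.mem_filter, Finset.mem_univ, true_and] at hp ⊢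
            exact hp.1
      _ = d := card_filter_val_lt hdn
  have hτpos : 0 < τ ↔ P.f v = (P.h i).decided := by
    rw [P.f_eq i, BoolOp.eval_eq_decided_iff, hτ, Finset.card_pos]
    constructor
    · rintro ⟨p, hp⟩
      simp only [Finset.mem_filter, Finset.mem_univ, true_and] at hp
      exact ⟨_, List.getElem_mem hp.1, (marked_iff P t i ht b p hp.1).1 hp.2⟩
    · rintro ⟨w, hw, hfw⟩
      obtain ⟨p, hp, rfl⟩ := List.getElem_of_mem hw
      refine ⟨⟨p, hp.trans_le hdn⟩, ?_⟩
      simp only [Finset.mem_filter, Finset.mem_univ, true_and]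
      exact ⟨hp, (marked_iff P t i ht b ⟨p, hp.trans_le hdn⟩ hp).2 hfw⟩
  have hfail := QueryAlg.tryAll_failure (searchAttempt v d b)
    (fun _ z => foundFlag v b (negPerm _ _ _ z)) (P.h i).decided (P.blackBox t) (schedule d R)
  have hprod : ((schedule d R).map fun a =>
      ∑ z : Addr N L × Ans N L × (Addr N L × Ans N L),
        (if foundFlag v b (negPerm _ _ _ z) then 0 else
          (searchAttempt v d b a).measure (P.blackBox t) z)).prod =
      ENNReal.ofReal ((schedule d R).map (attemptFailure d τ)).prod := by
    have hall : ∀ l : List (ℕ × ℝ), (∀ a ∈ l, 0 ≤ a.2 ∧ a.2 ≤ 1) → (l.map fun a =>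
      ∑ z : Addr N L × Ans N L × (Addr N L × Ans N L),
        (if foundFlag v b (negPerm _ _ _ z) then 0 else
          (searchAttempt v d b a).measure (P.blackBox t) z)).prod =
      ENNReal.ofReal (l.map (attemptFailure d τ)).prod := by
      intro l hl
      induction l with
      | nil => simp
      | cons a l ih =>
        obtain ⟨h0, h1⟩ := hl a (by simp)
        have hfrac : a.2 * τ / d ≤ 1 := by
          rw [div_le_one (by exact_mod_cast hd0)]
          calc a.2 * τ ≤ 1 * τ := by gcongr
            _ ≤ d := by rw [one_mul]; exact_mod_cast hτd
        have hθ : a.2 * τ / d = Real.sin (Real.arcsin √(a.2 * τ / d)) ^ 2 := by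
          rw [Real.sin_arcsin (by linarith [Real.sqrt_nonneg (a.2 * τ / d)])
            (Real.sqrt_le_one.2 hfrac), Real.sq_sqrt (by positivity)]
        rw [List.map_cons, List.map_cons, List.prod_cons, List.prod_cons,
          ih fun a' ha' => hl a' (List.mem_cons_of_mem _ ha'),
          ENNReal.ofReal_mul (attemptFailure_nonneg _ _ _),
          searchAttempt_failure (P.blackBox t) v b hd0 hdn a h0 h1 _ hθ]
        rfl
    exact hall _ fun a ha => schedule_weight_mem ha
  rw [vertexAlg_exec, PMF.toOuterMeasure_map_apply]
  have hfail' := hfail.trans hprod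
  rcases Nat.eq_zero_or_pos τ with h0 | hpos
  · have hne : P.f v = !(P.h i).decided := by
      have : P.f v ≠ (P.h i).decided := fun h => by
        have := hτpos.2 h
        omega
      revert this
      cases P.f v <;> cases (P.h i).decided <;> simp
    rw [h0] at hfail'
    have hone : ((schedule d R).map (attemptFailure d 0)).prod = 1 :=
      List.prod_eq_one fun y hy => by
        obtain ⟨a, -, rfl⟩ := List.mem_map.1 hy
        simp
    rw [hone, ENNReal.ofReal_one] at hfail'
    rw [hne]
    exact (PMF.toOuterMeasure_ne_eq_zero _ _ hfail').le.trans zero_le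
  · have hset : ((fun s : Bool × ℕ => (s.1, 2 + s.2)) ⁻¹' {s | s.1 ≠ P.f v}) =
        {s | s.1 = !(P.h i).decided} := by
      ext s
      simp only [Set.mem_preimage, Set.mem_ofPred_eq, hτpos.1 hpos]
      cases s.1 <;> cases (P.h i).decided <;> simp
    rw [hset]
    refine hfail'.le.trans (ENNReal.ofReal_le_ofReal ?_)
    exact prod_attemptFailure_schedule_le hR hpos hτd

end Vertex

/-! ### The whole run -/

section Run

variable {N L : ℕ}

/-- The run restricted to the vertices of a list, the last of which is processed first. -/
def BoolDP.runList (P : BoolDP N L) (Q : Fin N → QueryAlg (Addr N L) (Ans N L) Bool)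
    (l : List (Fin N)) : PMF ((Fin N → Bool) × ℕ) :=
  l.foldr (fun i p => p.bind (P.step Q i)) (PMF.pure (fun _ => false, 0))

theorem BoolDP.runList_queries_le (P : BoolDP N L)
    (Q : Fin N → QueryAlg (Addr N L) (Ans N L) Bool) (B : Fin N → ℝ)
    (hB : ∀ t i, ∀ s ∈ ((Q i).exec (P.blackBox t)).support, (s.2 : ℝ) ≤ B i)
    (l : List (Fin N)) :
    ∀ s ∈ (P.runList Q l).support, (s.2 : ℝ) ≤ (l.map B).sum := by
  induction l with
  | nil => simp [BoolDP.runList]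
  | cons i l ih =>
    intro s hs
    rw [BoolDP.runList, List.foldr_cons, PMF.mem_support_bind_iff] at hs
    obtain ⟨r, hr, hs⟩ := hs
    rw [BoolDP.step, PMF.support_map] at hs
    obtain ⟨u, hu, rfl⟩ := hs
    rw [List.map_cons, List.sum_cons]
    push_cast
    linarith [ih r hr, hB r.1 i u hu]

theorem BoolDP.runsWithin_of_le (P : BoolDP N L)
    (Q : Fin N → QueryAlg (Addr N L) (Ans N L) Bool) (B : Fin N → ℝ)
    (hB : ∀ t i, ∀ s ∈ ((Q i).exec (P.blackBox t)).support, (s.2 : ℝ) ≤ B i) :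
    P.RunsWithin Q (∑ i, B i) := by
  rw [Fin.sum_univ_def]
  exact P.runList_queries_le Q B hB _

theorem PMF.toOuterMeasure_apply_le_one {α : Type} (p : PMF α) (s : Set α) :
    p.toOuterMeasure s ≤ 1 := by
  rw [PMF.toOuterMeasure_apply, ← p.tsum_coe]
  exact ENNReal.tsum_le_tsum fun a => Set.indicator_le_self' (fun _ _ => zero_le) a

/-- The union bound over the vertices. The list has to contain, with a vertex, all later ones, so
that the results on which a vertex depends are already in the array. -/
theorem BoolDP.runList_error_le (P : BoolDP N L)
    (Q : Fin N → QueryAlg (Addr N L) (Ans N L) Bool) (ε : ENNReal)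
    (hQ : ∀ t i, (∀ j, i < j → t j = P.f (Fin.castAdd L j)) →
      ((Q i).exec (P.blackBox t)).toOuterMeasure {s | s.1 ≠ P.f (Fin.castAdd L i)} ≤ ε)
    (l : List (Fin N)) (hl : l.Pairwise (· < ·)) (hup : ∀ i ∈ l, ∀ j, i < j → j ∈ l) :
    (P.runList Q l).toOuterMeasure {s | ∃ i ∈ l, s.1 i ≠ P.f (Fin.castAdd L i)} ≤
      l.length * ε := by
  induction l with
  | nil => simp
  | cons i l ih =>
    obtain ⟨hi, hl'⟩ := List.pairwise_cons.1 hl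
    have hlater : ∀ j, i < j → j ∈ l := fun j hj =>
      (List.mem_cons.1 (hup i (by simp) j hj)).resolve_left hj.ne'
    have hup' : ∀ k ∈ l, ∀ j, k < j → j ∈ l := fun k hk j hj => hlater j ((hi k hk).trans hj)
    set bad : Set ((Fin N → Bool) × ℕ) := {s | ∃ j ∈ l, s.1 j ≠ P.f (Fin.castAdd L j)} with hbad
    have hstep : ∀ s, (P.runList Q l) s * (P.step Q i s).toOuterMeasure
        {s | ∃ j ∈ i :: l, s.1 j ≠ P.f (Fin.castAdd L j)} ≤
        bad.indicator (P.runList Q l) s + (P.runList Q l) s * ε := by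
      intro s
      by_cases hs : s ∈ bad
      · rw [Set.indicator_of_mem hs]
        refine le_add_right ?_
        exact mul_le_of_le_one_right zero_le (PMF.toOuterMeasure_apply_le_one _ _)
      · rw [Set.indicator_of_notMem hs, zero_add]
        have hgood : ∀ j ∈ l, s.1 j = P.f (Fin.castAdd L j) := by
          simpa [hbad] using hs
        gcongr
        refine le_trans ?_ (hQ s.1 i fun j hj => hgood j (hlater j hj))
        rw [BoolDP.step, PMF.toOuterMeasure_map_apply]
        refine MeasureTheory.measure_mono ?_
        rintro r ⟨j, hj, hne⟩
        rcases List.mem_cons.1 hj with rfl | hj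
        · simpa using hne
        · simp only [Function.update_of_ne (hi j hj).ne'] at hne
          exact (hne (hgood j hj)).elim
    calc (P.runList Q (i :: l)).toOuterMeasure {s | ∃ j ∈ i :: l, s.1 j ≠ P.f (Fin.castAdd L j)}
        = ∑' s, (P.runList Q l) s * (P.step Q i s).toOuterMeasure
            {s | ∃ j ∈ i :: l, s.1 j ≠ P.f (Fin.castAdd L j)} := by
          rw [BoolDP.runList, List.foldr_cons, PMF.toOuterMeasure_bind_apply]; rfl
      _ ≤ ∑' s, (bad.indicator (P.runList Q l) s + (P.runList Q l) s * ε) :=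
          ENNReal.tsum_le_tsum hstep
      _ = (P.runList Q l).toOuterMeasure bad + ε := by
          rw [ENNReal.tsum_add, ENNReal.tsum_mul_right, PMF.tsum_coe, one_mul,
            PMF.toOuterMeasure_apply]
      _ ≤ l.length * ε + ε := by gcongr; exact ih hl' hup'
      _ = (i :: l).length * ε := by
          rw [List.length_cons]; push_cast; ring

theorem BoolDP.errorProb_le (P : BoolDP N L)
    (Q : Fin N → QueryAlg (Addr N L) (Ans N L) Bool) (ε : ENNReal)
    (hQ : ∀ t i, (∀ j, i < j → t j = P.f (Fin.castAdd L j)) →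
      ((Q i).exec (P.blackBox t)).toOuterMeasure {s | s.1 ≠ P.f (Fin.castAdd L i)} ≤ ε) :
    P.errorProb Q ≤ N * ε := by
  have h := P.runList_error_le Q ε hQ (List.finRange N) (List.pairwise_lt_finRange N)
    fun _ _ j _ => List.mem_finRange j
  simpa [BoolDP.errorProb, BoolDP.run, BoolDP.runList] using h

/-! ### The total number of queries -/

theorem SortedDAG.sum_length_le (G : SortedDAG N L) :
    ∑ i : Fin N, (G.D (Fin.castAdd L i)).length ≤ G.m := by
  have hm : G.m = ∑ v, (G.D v).length := by
    rw [SortedDAG.m, SortedDAG.edges, Finset.card_filter, Fintype.sum_prod_type]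
    refine Finset.sum_congr rfl fun v _ => ?_
    rw [← Finset.card_filter, ← List.toFinset_card_of_nodup (G.nodup v)]
    congr 1
    ext w
    simp
  rw [hm, Fin.sum_univ_add]
  exact Nat.le_add_right _ _

/-- The Cauchy-Schwarz inequality turns the costs `√(d R)` of the single vertices into the total
cost. -/
theorem sum_vertex_queries_le (G : SortedDAG N L) {R : ℕ} (hR : 0 < R) :
    ∑ i : Fin N, (2 + 26 * √(((G.D (Fin.castAdd L i)).length : ℝ) * R)) ≤
      28 * √((N : ℝ) * G.m * R) := by
  have hR' : (1 : ℝ) ≤ R := by exact_mod_cast hR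
  have h1 : ∀ i : Fin N, 1 ≤ √(((G.D (Fin.castAdd L i)).length : ℝ) * R) := by
    intro i
    have : (1 : ℝ) ≤ (G.D (Fin.castAdd L i)).length := by
      exact_mod_cast List.length_pos_iff.2 (G.nonsink i)
    rw [Real.one_le_sqrt]
    nlinarith
  have hsq : (∑ i : Fin N, √(((G.D (Fin.castAdd L i)).length : ℝ) * R)) ^ 2 ≤ N * G.m * R := by
    calc (∑ i : Fin N, √(((G.D (Fin.castAdd L i)).length : ℝ) * R)) ^ 2
        ≤ N * ∑ i : Fin N, √(((G.D (Fin.castAdd L i)).length : ℝ) * R) ^ 2 := by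
          simpa using sq_sum_le_card_mul_sum_sq (s := Finset.univ)
            (f := fun i : Fin N => √(((G.D (Fin.castAdd L i)).length : ℝ) * R))
      _ = N * ((∑ i : Fin N, ((G.D (Fin.castAdd L i)).length : ℝ)) * R) := by
          rw [Finset.sum_mul]
          congr 1
          exact Finset.sum_congr rfl fun i _ => Real.sq_sqrt (by positivity)
      _ ≤ N * (G.m * R) := by
          gcongr
          exact_mod_cast G.sum_length_le
      _ = N * G.m * R := by ring
  calc ∑ i : Fin N, (2 + 26 * √(((G.D (Fin.castAdd L i)).length : ℝ) * R))
      ≤ ∑ i : Fin N, 28 * √(((G.D (Fin.castAdd L i)).length : ℝ) * R) :=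
        Finset.sum_le_sum fun i _ => by linarith [h1 i]
    _ = 28 * ∑ i : Fin N, √(((G.D (Fin.castAdd L i)).length : ℝ) * R) := by rw [Finset.mul_sum]
    _ ≤ 28 * √((N : ℝ) * G.m * R) := by
        gcongr
        exact Real.le_sqrt_of_sq_le hsq

theorem BoolDP.RunsWithin.mono {P : BoolDP N L}
    {Q : Fin N → QueryAlg (Addr N L) (Ans N L) Bool} {B B' : ℝ} (h : P.RunsWithin Q B)
    (hB : B ≤ B') : P.RunsWithin Q B' := fun s hs => (h s hs).trans hB

/-! ### The number of repetitions -/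

/-- The parameter of the search at every vertex, chosen such that its probability of error is at
most `1 / N ^ 2`: as `3 / 4 ≤ exp (-1 / 4)`, the factor `8` gives `(3 / 4) ^ R ≤ exp (-2 log N)`. -/
def repetitions (N : ℕ) : ℕ := ⌈8 * Real.log N⌉₊

theorem repetitions_pos {N : ℕ} (hN : 2 ≤ N) : 0 < repetitions N :=
  Nat.ceil_pos.2 (by have := Real.log_pos (by exact_mod_cast hN : (1 : ℝ) < N); positivity)

theorem repetitions_le {N : ℕ} (hN : 2 ≤ N) : (repetitions N : ℝ) ≤ 10 * Real.log N := by
  have h2 : Real.log 2 ≤ Real.log N := Real.log_le_log two_pos (by exact_mod_cast hN)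
  have hc : (repetitions N : ℝ) < 8 * Real.log N + 1 :=
    Nat.ceil_lt_add_one (by linarith [Real.log_two_gt_d9])
  linarith [Real.log_two_gt_d9]

theorem pow_repetitions_le {N : ℕ} (hN : 2 ≤ N) :
    (3 / 4 : ℝ) ^ repetitions N ≤ 1 / (N : ℝ) ^ 2 := by
  have hN0 : (0 : ℝ) < N := by positivity
  have h34 : (3 / 4 : ℝ) ≤ Real.exp (-(1 / 4)) := by
    linarith [Real.add_one_le_exp (-(1 / 4) : ℝ)]
  have hc : 8 * Real.log N ≤ repetitions N := Nat.le_ceil _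
  calc (3 / 4 : ℝ) ^ repetitions N ≤ Real.exp (-(1 / 4)) ^ repetitions N := by gcongr
    _ = Real.exp (repetitions N * -(1 / 4)) := by rw [Real.exp_nat_mul]
    _ ≤ Real.exp (-(2 * Real.log N)) := Real.exp_le_exp.2 (by linarith)
    _ = 1 / (N : ℝ) ^ 2 := by
      rw [Real.exp_neg, ← Nat.cast_two (R := ℝ), Real.exp_nat_mul, Real.exp_log hN0, one_div]

theorem run_vertexAlg (P : BoolDP N L) (hN : 2 ≤ N) :
    P.RunsWithin (vertexAlg (repetitions N)) (100 * √((N : ℝ) * (P.G.m : ℝ) * Real.log (N : ℝ))) ∧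
      P.errorProb (vertexAlg (repetitions N)) ≤ ENNReal.ofReal (100 / (N : ℝ)) := by
  have hN0 : (0 : ℝ) < N := by positivity
  constructor
  · refine (P.runsWithin_of_le _ (fun i => 2 + 26 *
      √(((P.G.D (Fin.castAdd L i)).length : ℝ) * repetitions N)) fun t i s hs => ?_).mono
        ((sum_vertex_queries_le P.G (repetitions_pos hN)).trans ?_)
    · have h : (s.2 : ℝ) ≤ _ := Nat.cast_le.2 (vertexAlg_queries_le _ P t i s hs)
      push_cast at h
      have := sum_queries_schedule_le (P.G.D (Fin.castAdd L i)).length (repetitions N)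
      push_cast at this
      linarith
    · calc 28 * √((N : ℝ) * P.G.m * repetitions N)
          ≤ 28 * √(10 * ((N : ℝ) * P.G.m * Real.log N)) := by
            refine mul_le_mul_of_nonneg_left (Real.sqrt_le_sqrt ?_) (by norm_num)
            calc (N : ℝ) * P.G.m * repetitions N ≤ N * P.G.m * (10 * Real.log N) := by
                  gcongr; exact repetitions_le hN
              _ = 10 * ((N : ℝ) * P.G.m * Real.log N) := by ring
        _ = 28 * (√10 * √((N : ℝ) * P.G.m * Real.log N)) := by
            rw [Real.sqrt_mul (by norm_num)]
        _ ≤ 28 * (7 / 2 * √((N : ℝ) * P.G.m * Real.log N)) := by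
            gcongr
            rw [Real.sqrt_le_left (by norm_num)]
            norm_num
        _ ≤ 100 * √((N : ℝ) * P.G.m * Real.log N) := by
            linarith [Real.sqrt_nonneg ((N : ℝ) * P.G.m * Real.log N)]
  · refine (P.errorProb_le _ _ fun t i ht =>
      vertexAlg_error_le (repetitions_pos hN) P t i ht).trans ?_
    rw [← ENNReal.ofReal_natCast, ← ENNReal.ofReal_mul (Nat.cast_nonneg N)]
    refine ENNReal.ofReal_le_ofReal ?_
    calc (N : ℝ) * (3 / 4) ^ repetitions N ≤ N * (1 / (N : ℝ) ^ 2) := by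
          gcongr; exact pow_repetitions_le hN
      _ = 1 / N := by field_simp
      _ ≤ 100 / N := by gcongr; norm_num

end Run

end

theorem lemma6 :
    ∃ C : ℝ, 0 < C ∧ ∀ N L : ℕ, 1 ≤ N →
      ∃ Q : Fin N → QueryAlg (Addr N L) (Ans N L) Bool,
        ∀ P : BoolDP N L,
          P.RunsWithin Q (C * √((N : ℝ) * (P.G.m : ℝ) * Real.log (N : ℝ))) ∧
          P.RunsWithin Q
            (C * √(((N + L : ℕ) : ℝ) * (P.G.m : ℝ) * Real.log ((N + L : ℕ) : ℝ))) ∧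
          P.errorProb Q ≤ ENNReal.ofReal (C / (N : ℝ)) := by
  suffices h : ∀ N L : ℕ, 1 ≤ N → ∃ Q : Fin N → QueryAlg (Addr N L) (Ans N L) Bool,
      ∀ P : BoolDP N L, P.RunsWithin Q (100 * √((N : ℝ) * (P.G.m : ℝ) * Real.log (N : ℝ))) ∧
        P.errorProb Q ≤ ENNReal.ofReal (100 / (N : ℝ)) by
    refine ⟨100, by norm_num, fun N L hN => ?_⟩
    obtain ⟨Q, hQ⟩ := h N L hN
    refine ⟨Q, fun P => ⟨(hQ P).1, (hQ P).1.mono ?_, (hQ P).2⟩⟩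
    have hNL : (N : ℝ) ≤ ((N + L : ℕ) : ℝ) := by exact_mod_cast Nat.le_add_right N L
    have hN0 : (0 : ℝ) < N := by exact_mod_cast hN
    have hlog : 0 ≤ Real.log N := Real.log_natCast_nonneg N
    gcongr
  intro N L hN
  rcases hN.eq_or_lt with rfl | hN
  · -- As `log 1 = 0`, no query is allowed; the bound on the error probability is trivial.
    refine ⟨fun _ => .ret false, fun P => ⟨?_, ?_⟩⟩
    · refine (P.runsWithin_of_le _ (fun _ => 0) fun t i s hs => ?_).mono (by simp)
      simp only [QueryAlg.exec, PMF.support_pure, Set.mem_singleton_iff] at hs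
      simp [hs]
    · refine (PMF.toOuterMeasure_apply_le_one _ _).trans ?_
      rw [← ENNReal.ofReal_one]
      exact ENNReal.ofReal_le_ofReal (by norm_num)
  · exact ⟨vertexAlg (repetitions N), fun P => run_vertexAlg P hN⟩
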